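/- Let $m\ge 1$, let $(\Omega,\mathscr R,\mathsf{Pr})$ be a probability space, and let $W(0),W(1),W(2),\dots$ be independent random $m\times m$ row-stochastic matrices defined on it (entries nonnegative, each row summing to $1$). Suppose that: (i) there is a vector $\pi\in\mathbb R^m$ with $\pi_i>0$ for all $i$ and $\sum_i\pi_i=1$ such that $\pi^T\,\mathsf E[W(k)]=\pi^T$ for all $k\ge 0$ (a common steady state $\pi>0$ in expectation); (ii) there is $\gamma>0$ such that for all $k\ge0$ and all $i\ne j$ in $\{1,\dots,m\}$ $$\mathsf E\Big[\sum_{\ell=1}^m W_{\ell i}(k)W_{\ell j}(k)\Big]\ \ge\ \gamma\,\big(\mathsf E[W_{ij}(k)]+\mathsf E[W_{ji}(k)]\big)$$ (weak feedback property). For a deterministic sequence $\{G(k)\}_{k\ge0}$ of row-stochastic $m\times m$ matrices, say that $\{G(k)\}$ is \emph{ergodic} if for all $t\ge0$ and $j$ there is a scalar $g_j(t)$ such that $\lim_{k\to\infty}\big(G(k)G(k-1)\cdots G(t)\big)_{ij}=g_j(t)$ for all $i$; and say that $\{G(k)\}$ \emph{has infinite flow} if $\sum_{k=0}^\infty\sum_{i\in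 S,\,j\notin S}\big(G_{ij}(k)+G_{ji}(k)\big)=\infty$ for every nonempty proper subset $S$ of $\{1,\dots,m\}$. Then the following conditions are equivalent: (a) almost surely, the chain $\{W(k)\}$ is ergodic; (b) almost surely, the chain $\{W(k)\}$ has infinite flow; (c) the expected chain $\{\mathsf E[W(k)]\}$ has infinite flow; (d) the expected chain $\{\mathsf E[W(k)]\}$ is ergodic. -/

import Mathlib

open MeasureTheory ProbabilityTheory Filter Topology

/-- The sigma-algebra on real matrices: the product sigma-algebra on the entries, which is the
Borel sigma-algebra (see the next instance). -/
instance instMeasurableSpaceRealMatrix {m : ℕ} : MeasurableSpace (Matrix (Fin m) (Fin m) ℝ) :=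
  inferInstanceAs (MeasurableSpace (Fin m → Fin m → ℝ))

instance instBorelSpaceRealMatrix {m : ℕ} : BorelSpace (Matrix (Fin m) (Fin m) ℝ) :=
  inferInstanceAs (BorelSpace (Fin m → Fin m → ℝ))

/-- The product `G (t + n) * ⋯ * G (t + 1) * G t`. -/
noncomputable def backwardProduct {m : ℕ} (G : ℕ → Matrix (Fin m) (Fin m) ℝ) (t : ℕ) :
    ℕ → Matrix (Fin m) (Fin m) ℝ
  | 0 => G t
  | n + 1 => G (t + n + 1) * backwardProduct G t n

/-- The transition matrix `Φ(k, t) = G(k) G(k-1) ⋯ G(t)` for `k ≥ t`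
(the values for `k < t` are irrelevant: only limits as `k → ∞` are used). -/
noncomputable def transitionMatrix {m : ℕ} (G : ℕ → Matrix (Fin m) (Fin m) ℝ) (k t : ℕ) :
    Matrix (Fin m) (Fin m) ℝ :=
  backwardProduct G t (k - t)

/-- A deterministic chain is ergodic if for all `t` and `j` there is a scalar `g` such that
`Φ(k, t) i j → g` as `k → ∞`, for every `i`. -/
def IsErgodicChain {m : ℕ} (G : ℕ → Matrix (Fin m) (Fin m) ℝ) : Prop :=
  ∀ (t : ℕ) (j : Fin m), ∃ g : ℝ, ∀ i : Fin m,
    Tendsto (fun k : ℕ => transitionMatrix G k t i j) atTop (𝓝 g)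

/-- The flow `∑_{i ∈ S, j ∉ S} (A i j + A j i)` across the cut `(S, Sᶜ)`. -/
def cutFlow {m : ℕ} (A : Matrix (Fin m) (Fin m) ℝ) (S : Finset (Fin m)) : ℝ :=
  ∑ i ∈ S, ∑ j ∈ Sᶜ, (A i j + A j i)

/-- A deterministic chain has infinite flow if for every nonempty proper subset `S` of the
index set the total flow `∑_k G_S(k)` is infinite, i.e. its partial sums tend to `+∞`. -/
def HasInfiniteFlow {m : ℕ} (G : ℕ → Matrix (Fin m) (Fin m) ℝ) : Prop :=
  ∀ S : Finset (Fin m), S.Nonempty → S ≠ Finset.univ →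
    Tendsto (fun n : ℕ => ∑ k ∈ Finset.range n, cutFlow (G k) S) atTop atTop

/-- The expected chain `k ↦ E[W(k)]`, with the expectation taken entrywise. -/
noncomputable def expectedChain {Ω : Type*} [MeasurableSpace Ω] {m : ℕ} (P : Measure Ω)
    (W : ℕ → Ω → Matrix (Fin m) (Fin m) ℝ) : ℕ → Matrix (Fin m) (Fin m) ℝ :=
  fun k => Matrix.of fun i j => ∫ ω, W k ω i j ∂P

/-- Weak feedback property: for some `γ > 0`, the expected inner product of the `i`th and `j`th
columns of `W(k)` is at least `γ (E[W_ij(k)] + E[W_ji(k)])`, for all `k` and all `i ≠ j`. -/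
def HasWeakFeedback {Ω : Type*} [MeasurableSpace Ω] {m : ℕ} (P : Measure Ω)
    (W : ℕ → Ω → Matrix (Fin m) (Fin m) ℝ) : Prop :=
  ∃ γ : ℝ, 0 < γ ∧ ∀ (k : ℕ) (i j : Fin m), i ≠ j →
    γ * ((∫ ω, W k ω i j ∂P) + ∫ ω, W k ω j i ∂P) ≤
      ∫ ω, (∑ l : Fin m, W k ω l i * W k ω l j) ∂P

/-- `π` is a common steady state in expectation: a stochastic vector with
`πᵀ E[W(k)] = πᵀ` for all `k`. -/
def IsCommonSteadyState {Ω : Type*} [MeasurableSpace Ω] {m : ℕ} (P : Measure Ω)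
    (W : ℕ → Ω → Matrix (Fin m) (Fin m) ℝ) (π : Fin m → ℝ) : Prop :=
  (∀ i, 0 ≤ π i) ∧ ∑ i, π i = 1 ∧ ∀ k, Matrix.vecMul π (expectedChain P W k) = π

/-! The proof runs through the cycle (a) → (d) → (c) → (b) → (a).

(a) → (d): by independence the expected trajectory is the trajectory of the expected chain
(`integral_stateTrajectory`), and dominated convergence passes to the limit. (d) → (c): for any
row-stochastic chain, if a cut had finite total flow, a late start from the indicator of one side
would keep the two sides apart forever (`IsErgodicChain.hasInfiniteFlow`). (c) → (b): for a fixed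
cut the flows are independent, nonnegative and bounded, so divergence of their expectations forces
almost sure divergence; there are finitely many cuts.

(b) → (a) is the core, and the place where `π` and weak feedback enter. The energy `∑ l, π l * x l ^
2` drops in expectation at each step by at least a constant times the expected dissipation, so along
almost every trajectory the total dissipation is finite (`ae_summable_dissipation`). Pathwise,
infinite flow is then enough: if the spread did not tend to 0, then from every time on a fixed
amount of energy would still be dissipated, because a spread-out state has two separated clusters
that cannot merge before a definite flow has crossed between them (`exists_le_sum_dissipation`). -/

open Matrix in
/-- The trajectory of the dynamics `x(n + 1) = G (t + n) x(n)` started at `x`. -/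
noncomputable def stateTrajectory {m : ℕ} (G : ℕ → Matrix (Fin m) (Fin m) ℝ) (t : ℕ)
    (x : Fin m → ℝ) : ℕ → Fin m → ℝ
  | 0 => x
  | n + 1 => G (t + n) *ᵥ stateTrajectory G t x n

/-! ### Trajectories of a row-stochastic chain. -/

section Deterministic

variable {m : ℕ}

lemma rowStochastic_entry_nonneg {A : Matrix (Fin m) (Fin m) ℝ}
    (hA : A ∈ Matrix.rowStochastic ℝ (Fin m)) (i j : Fin m) : 0 ≤ A i j :=
  Matrix.nonneg_of_mem_rowStochastic hA

lemma rowStochastic_row_sum {A : Matrix (Fin m) (Fin m) ℝ}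
    (hA : A ∈ Matrix.rowStochastic ℝ (Fin m)) (i : Fin m) : ∑ j, A i j = 1 :=
  Matrix.sum_row_of_mem_rowStochastic hA i

lemma rowStochastic_entry_le_one {A : Matrix (Fin m) (Fin m) ℝ}
    (hA : A ∈ Matrix.rowStochastic ℝ (Fin m)) (i j : Fin m) : A i j ≤ 1 := by
  rw [← rowStochastic_row_sum hA i]
  exact Finset.single_le_sum (fun j _ => rowStochastic_entry_nonneg hA i j) (Finset.mem_univ j)

lemma le_mulVec_of_rowStochastic {A : Matrix (Fin m) (Fin m) ℝ}
    (hA : A ∈ Matrix.rowStochastic ℝ (Fin m)) {x : Fin m → ℝ} {c : ℝ} (hx : ∀ i, c ≤ x i)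
    (i : Fin m) : c ≤ A.mulVec x i := by
  calc c = ∑ j, A i j * c := by rw [← Finset.sum_mul, rowStochastic_row_sum hA, one_mul]
    _ ≤ ∑ j, A i j * x j := Finset.sum_le_sum fun j _ =>
        mul_le_mul_of_nonneg_left (hx j) (rowStochastic_entry_nonneg hA i j)

lemma mulVec_le_of_rowStochastic {A : Matrix (Fin m) (Fin m) ℝ}
    (hA : A ∈ Matrix.rowStochastic ℝ (Fin m)) {x : Fin m → ℝ} {c : ℝ} (hx : ∀ i, x i ≤ c)
    (i : Fin m) : A.mulVec x i ≤ c := by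
  calc ∑ j, A i j * x j ≤ ∑ j, A i j * c := Finset.sum_le_sum fun j _ =>
        mul_le_mul_of_nonneg_left (hx j) (rowStochastic_entry_nonneg hA i j)
    _ = c := by rw [← Finset.sum_mul, rowStochastic_row_sum hA, one_mul]

lemma stateTrajectory_mem_Icc {G : ℕ → Matrix (Fin m) (Fin m) ℝ}
    (hG : ∀ k, G k ∈ Matrix.rowStochastic ℝ (Fin m)) (t : ℕ) {x : Fin m → ℝ} {a b : ℝ}
    (hx : ∀ i, x i ∈ Set.Icc a b) (n : ℕ) (i : Fin m) :
    stateTrajectory G t x n i ∈ Set.Icc a b := by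
  induction n generalizing i with
  | zero => exact hx i
  | succ n ih =>
    exact ⟨le_mulVec_of_rowStochastic (hG _) (fun j => (ih j).1) i,
      mulVec_le_of_rowStochastic (hG _) (fun j => (ih j).2) i⟩

lemma stateTrajectory_succ_eq_backwardProduct (G : ℕ → Matrix (Fin m) (Fin m) ℝ) (t : ℕ)
    (x : Fin m → ℝ) (n : ℕ) :
    stateTrajectory G t x (n + 1) = (backwardProduct G t n).mulVec x := by
  induction n with
  | zero => rfl
  | succ n ih =>
    rw [stateTrajectory, ih, backwardProduct, Matrix.mulVec_mulVec, add_assoc]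

/-- Ergodicity in terms of the trajectories started at the coordinate vectors. -/
lemma isErgodicChain_iff_stateTrajectory (G : ℕ → Matrix (Fin m) (Fin m) ℝ) :
    IsErgodicChain G ↔ ∀ (t : ℕ) (j : Fin m), ∃ g : ℝ, ∀ i : Fin m,
      Tendsto (fun n => stateTrajectory G t (Pi.single j 1) n i) atTop (𝓝 g) := by
  refine forall_congr' fun t => forall_congr' fun j => exists_congr fun g => forall_congr' fun i => ?_
  -- Shifting by `t` removes the truncated subtraction `k - t`; shifting by 1 matches the `n + 1`
  -- factors of `backwardProduct G t n`.
  rw [← tendsto_add_atTop_iff_nat t, ← tendsto_add_atTop_iff_nat (f := fun n =>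
    stateTrajectory G t (Pi.single j 1) n i) 1]
  simp [transitionMatrix, stateTrajectory_succ_eq_backwardProduct]

/-- An ergodic chain drives every initial state to consensus. -/
lemma IsErgodicChain.exists_tendsto_stateTrajectory {G : ℕ → Matrix (Fin m) (Fin m) ℝ}
    (hG : IsErgodicChain G) (t : ℕ) (x : Fin m → ℝ) :
    ∃ g : ℝ, ∀ i, Tendsto (fun n => stateTrajectory G t x n i) atTop (𝓝 g) := by
  rw [isErgodicChain_iff_stateTrajectory] at hG
  choose g hg using hG t
  refine ⟨∑ j, g j * x j, fun i => ?_⟩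
  rw [← tendsto_add_atTop_iff_nat 1]
  have h := tendsto_finsetSum Finset.univ fun j (_ : j ∈ Finset.univ) =>
    (((tendsto_add_atTop_iff_nat 1).2 (hg j i)).mul_const (x j))
  refine h.congr fun n => ?_
  simp [stateTrajectory_succ_eq_backwardProduct, Matrix.mulVec, dotProduct, Pi.single_apply]

/-! ### Flow across a cut, and its necessity for ergodicity. -/

lemma cutFlow_nonneg {A : Matrix (Fin m) (Fin m) ℝ}
    (hA : A ∈ Matrix.rowStochastic ℝ (Fin m)) (S : Finset (Fin m)) : 0 ≤ cutFlow A S :=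
  Finset.sum_nonneg fun i _ => Finset.sum_nonneg fun j _ =>
    add_nonneg (rowStochastic_entry_nonneg hA i j) (rowStochastic_entry_nonneg hA j i)

lemma sum_compl_row_le_cutFlow {A : Matrix (Fin m) (Fin m) ℝ}
    (hA : A ∈ Matrix.rowStochastic ℝ (Fin m)) {S : Finset (Fin m)} {i : Fin m} (hi : i ∈ S) :
    ∑ j ∈ Sᶜ, A i j ≤ cutFlow A S := by
  have hn := rowStochastic_entry_nonneg hA
  calc ∑ j ∈ Sᶜ, A i j ≤ ∑ j ∈ Sᶜ, (A i j + A j i) :=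
        Finset.sum_le_sum fun j _ => by linarith [hn j i]
    _ ≤ _ := Finset.single_le_sum (f := fun i => ∑ j ∈ Sᶜ, (A i j + A j i))
        (fun i _ => Finset.sum_nonneg fun j _ => add_nonneg (hn i j) (hn j i)) hi

lemma cutFlow_compl (A : Matrix (Fin m) (Fin m) ℝ) (S : Finset (Fin m)) :
    cutFlow A Sᶜ = cutFlow A S := by
  unfold cutFlow
  rw [Finset.sum_comm, compl_compl]
  simp only [add_comm]

/-- Row `i` puts total weight at most `cutFlow A S` outside `S`. Since the outside states are
nonnegative and `a ≤ 1`, moving that weight out costs at most `cutFlow A S`. -/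
lemma mulVec_ge_sub_cutFlow {A : Matrix (Fin m) (Fin m) ℝ}
    (hA : A ∈ Matrix.rowStochastic ℝ (Fin m)) {S : Finset (Fin m)} {x : Fin m → ℝ} {a : ℝ}
    (hx : ∀ i, x i ∈ Set.Icc (0 : ℝ) 1) (ha : ∀ i ∈ S, a ≤ x i) {i : Fin m} (hi : i ∈ S) :
    a - cutFlow A S ≤ A.mulVec x i := by
  have hn := rowStochastic_entry_nonneg hA
  have hsum := rowStochastic_row_sum hA i
  rw [← Finset.sum_add_sum_compl S] at hsum
  have h1 : ∑ j ∈ S, A i j * a ≤ ∑ j ∈ S, A i j * x j :=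
    Finset.sum_le_sum fun j hj => mul_le_mul_of_nonneg_left (ha j hj) (hn i j)
  have h2 : 0 ≤ ∑ j ∈ Sᶜ, A i j * x j :=
    Finset.sum_nonneg fun j _ => mul_nonneg (hn i j) (hx j).1
  have h3 : A.mulVec x i = ∑ j ∈ S, A i j * x j + ∑ j ∈ Sᶜ, A i j * x j :=
    (Finset.sum_add_sum_compl S _).symm
  have h4 := sum_compl_row_le_cutFlow hA hi
  have h5 : 0 ≤ ∑ j ∈ Sᶜ, A i j := Finset.sum_nonneg fun j _ => hn i j
  have h6 : a ≤ 1 := (ha i hi).trans (hx i).2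
  rw [← Finset.sum_mul] at h1
  nlinarith

lemma mulVec_le_add_cutFlow {A : Matrix (Fin m) (Fin m) ℝ}
    (hA : A ∈ Matrix.rowStochastic ℝ (Fin m)) {S : Finset (Fin m)} {x : Fin m → ℝ} {b : ℝ}
    (hx : ∀ i, x i ∈ Set.Icc (0 : ℝ) 1) (hb : ∀ i ∉ S, x i ≤ b) {i : Fin m} (hi : i ∉ S) :
    A.mulVec x i ≤ b + cutFlow A S := by
  -- The reflection `x ↦ 1 - x` exchanges the two sides of the cut.
  have h := mulVec_ge_sub_cutFlow hA (S := Sᶜ) (x := fun j => 1 - x j) (a := 1 - b)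
    (fun j => ⟨by linarith [(hx j).2], by linarith [(hx j).1]⟩)
    (fun j hj => by linarith [hb j (Finset.mem_compl.1 hj)]) (Finset.mem_compl.2 hi)
  have h' : A.mulVec (fun j => 1 - x j) i = 1 - A.mulVec x i := by
    simp [Matrix.mulVec, dotProduct, mul_sub, rowStochastic_row_sum hA i]
  rw [cutFlow_compl, h'] at h
  linarith

/-- Two clusters of states drift towards each other at most by the flow across the cut. -/
lemma stateTrajectory_cluster_bounds {G : ℕ → Matrix (Fin m) (Fin m) ℝ}
    (hG : ∀ k, G k ∈ Matrix.rowStochastic ℝ (Fin m)) (t : ℕ) {x : Fin m → ℝ}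
    (hx : ∀ i, x i ∈ Set.Icc (0 : ℝ) 1) {S : Finset (Fin m)} {a b : ℝ}
    (ha : ∀ i ∈ S, a ≤ x i) (hb : ∀ i ∉ S, x i ≤ b) (n : ℕ) :
    (∀ i ∈ S, a - ∑ k ∈ Finset.range n, cutFlow (G (t + k)) S ≤ stateTrajectory G t x n i) ∧
    (∀ i ∉ S, stateTrajectory G t x n i ≤ b + ∑ k ∈ Finset.range n, cutFlow (G (t + k)) S) := by
  induction n with
  | zero => simpa [stateTrajectory] using ⟨ha, hb⟩
  | succ n ih =>
    have hr := stateTrajectory_mem_Icc hG t hx n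
    simp only [Finset.sum_range_succ, ← sub_sub, ← add_assoc]
    exact ⟨fun i hi => mulVec_ge_sub_cutFlow (hG _) hr ih.1 hi,
      fun i hi => mulVec_le_add_cutFlow (hG _) hr ih.2 hi⟩

/-- Infinite flow is necessary for ergodicity of a stochastic chain. -/
theorem IsErgodicChain.hasInfiniteFlow {G : ℕ → Matrix (Fin m) (Fin m) ℝ}
    (hG : ∀ k, G k ∈ Matrix.rowStochastic ℝ (Fin m)) (h : IsErgodicChain G) :
    HasInfiniteFlow G := by
  classical
  intro S hS hS'
  by_contra hcon
  have h0 : ∀ k, 0 ≤ cutFlow (G k) S := fun k => cutFlow_nonneg (hG k) S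
  have hs : Summable fun k => cutFlow (G k) S :=
    (summable_iff_not_tendsto_nat_atTop_of_nonneg h0).2 hcon
  -- Start so late that the remaining flow is below 1/4: from the indicator of `S`, the states in
  -- `S` stay above 3/4 and the others below 1/4.
  obtain ⟨t, ht⟩ := ((tendsto_sum_nat_add fun k => cutFlow (G k) S).eventually_lt_const
    (show (0 : ℝ) < 1 / 4 by norm_num)).exists
  have hst : Summable fun k => cutFlow (G (t + k)) S := by
    simpa only [add_comm] using (summable_nat_add_iff t).2 hs
  have hpart : ∀ n, ∑ k ∈ Finset.range n, cutFlow (G (t + k)) S ≤ 1 / 4 := fun n => by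
    refine (hst.sum_le_tsum _ fun k _ => h0 _).trans ?_
    simpa only [add_comm] using ht.le
  let x : Fin m → ℝ := fun i => if i ∈ S then 1 else 0
  have hb := stateTrajectory_cluster_bounds hG t (x := x) (S := S) (a := 1) (b := 0)
    (fun i => by by_cases hi : i ∈ S <;> simp [x, hi])
    (fun i hi => by simp [x, hi]) (fun i hi => by simp [x, hi])
  obtain ⟨g, hg⟩ := h.exists_tendsto_stateTrajectory t x
  obtain ⟨i, hi⟩ := hS
  obtain ⟨j, hj⟩ : ∃ j, j ∉ S := by
    by_contra! hall
    exact hS' (Finset.eq_univ_iff_forall.2 hall)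
  have h1 : 3 / 4 ≤ g := ge_of_tendsto' (hg i) fun n => by
    linarith [(hb n).1 i hi, hpart n]
  have h2 : g ≤ 1 / 4 := le_of_tendsto' (hg j) fun n => by
    linarith [(hb n).2 j hj, hpart n]
  linarith

/-! ### Gaps, dissipation and consensus under infinite flow. -/

/-- Finitely many reals of spread at least `d` leave a gap of length `d / (m + 1)`. -/
lemma exists_gap {x : Fin m → ℝ} {d : ℝ} (hd : 0 < d) {p q : Fin m}
    (hpq : x p + d ≤ x q) :
    ∃ (S : Finset (Fin m)) (a b : ℝ), S.Nonempty ∧ S ≠ Finset.univ ∧ a - b = d / (m + 1) ∧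
      (∀ i ∈ S, a ≤ x i) ∧ ∀ i ∉ S, x i ≤ b := by
  classical
  set δ : ℝ := d / (m + 1) with hδ
  have hm : (0 : ℝ) < m + 1 := by positivity
  have hδ0 : 0 < δ := by positivity
  have hmd : (m + 1) * δ = d := by rw [hδ]; field_simp
  -- Pigeonhole: the `m + 1` disjoint half-open intervals of length `δ` above `x p` cannot all
  -- contain one of the `m` values. The free one has `r ≠ 0`, since `x p` lies in the first.
  obtain ⟨r, hr⟩ : ∃ r : Fin (m + 1), ∀ i, ¬ (x p + r * δ ≤ x i ∧ x i < x p + (r + 1) * δ) := by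
    by_contra! hall
    choose f hf using hall
    have hlt : ∀ r s : Fin (m + 1), r < s → f r ≠ f s := by
      intro r s hrs heq
      have h1 := (hf r).2
      have h2 := (hf s).1
      rw [heq] at h1
      have h3 : ((r : ℕ) : ℝ) + 1 ≤ ((s : ℕ) : ℝ) := by exact_mod_cast hrs
      nlinarith
    have hinj : Function.Injective f := fun r s h => by
      rcases lt_trichotomy r s with h' | h' | h'
      · exact absurd h (hlt r s h')
      · exact h'
      · exact absurd h.symm (hlt s r h')
    simpa using Fintype.card_le_of_injective f hinj
  have hrm : ((r : ℕ) : ℝ) + 1 ≤ m + 1 := by exact_mod_cast r.2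
  have hr0 : (1 : ℝ) ≤ ((r : ℕ) : ℝ) := by
    have : (r : ℕ) ≠ 0 := fun h => hr p (by simp [h, hδ0])
    exact_mod_cast Nat.one_le_iff_ne_zero.2 this
  refine ⟨Finset.univ.filter fun i => x p + (r + 1) * δ ≤ x i, x p + (r + 1) * δ, x p + r * δ,
    ⟨q, ?_⟩, ?_, by ring, ?_, ?_⟩
  · simp only [Finset.mem_filter, Finset.mem_univ, true_and]
    nlinarith
  · intro h
    have := Finset.eq_univ_iff_forall.1 h p
    simp only [Finset.mem_filter, Finset.mem_univ, true_and] at this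
    nlinarith
  · intro i hi
    simpa using hi
  · intro i hi
    simp only [Finset.mem_filter, Finset.mem_univ, true_and, not_le] at hi
    by_contra! h
    exact hr i ⟨h.le, hi⟩

/-- The energy dissipated across the links of `A` in the state `x`. -/
noncomputable def dissipation (A : Matrix (Fin m) (Fin m) ℝ) (x : Fin m → ℝ) : ℝ :=
  ∑ i, ∑ j, (A i j + A j i) * (x i - x j) ^ 2

lemma dissipation_nonneg {A : Matrix (Fin m) (Fin m) ℝ}
    (hA : A ∈ Matrix.rowStochastic ℝ (Fin m)) (x : Fin m → ℝ) : 0 ≤ dissipation A x :=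
  Finset.sum_nonneg fun i _ => Finset.sum_nonneg fun j _ => mul_nonneg
    (add_nonneg (rowStochastic_entry_nonneg hA i j) (rowStochastic_entry_nonneg hA j i))
    (sq_nonneg _)

lemma cutFlow_mul_sq_le_dissipation {A : Matrix (Fin m) (Fin m) ℝ}
    (hA : A ∈ Matrix.rowStochastic ℝ (Fin m)) {x : Fin m → ℝ} {S : Finset (Fin m)} {c : ℝ}
    (hc : 0 ≤ c) (hgap : ∀ i ∈ S, ∀ j ∉ S, c ≤ x i - x j) :
    cutFlow A S * c ^ 2 ≤ dissipation A x := by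
  have hn := fun i j => add_nonneg (rowStochastic_entry_nonneg hA i j)
    (rowStochastic_entry_nonneg hA j i)
  unfold cutFlow dissipation
  rw [Finset.sum_mul]
  calc ∑ i ∈ S, (∑ j ∈ Sᶜ, (A i j + A j i)) * c ^ 2
      ≤ ∑ i ∈ S, ∑ j, (A i j + A j i) * (x i - x j) ^ 2 := by
        refine Finset.sum_le_sum fun i hi => ?_
        rw [Finset.sum_mul]
        refine (Finset.sum_le_sum fun j hj => ?_).trans (Finset.sum_le_sum_of_subset_of_nonneg
          (Finset.subset_univ Sᶜ) fun j _ _ => mul_nonneg (hn i j) (sq_nonneg _))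
        have := hgap i hi j (Finset.mem_compl.1 hj)
        exact mul_le_mul_of_nonneg_left (by gcongr) (hn i j)
    _ ≤ _ := Finset.sum_le_sum_of_subset_of_nonneg (Finset.subset_univ S) fun i _ _ =>
        Finset.sum_nonneg fun j _ => mul_nonneg (hn i j) (sq_nonneg _)

lemma stateTrajectory_add (G : ℕ → Matrix (Fin m) (Fin m) ℝ) (t : ℕ) (x : Fin m → ℝ) (s n : ℕ) :
    stateTrajectory G t x (s + n) = stateTrajectory G (t + s) (stateTrajectory G t x s) n := by
  induction n with
  | zero => rfl
  | succ n ih => rw [← add_assoc, stateTrajectory, ih, stateTrajectory, add_assoc]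

/-- A state with spread `d` dissipates a fixed amount of energy under infinite flow. -/
lemma exists_le_sum_dissipation {G : ℕ → Matrix (Fin m) (Fin m) ℝ}
    (hG : ∀ k, G k ∈ Matrix.rowStochastic ℝ (Fin m)) (hflow : HasInfiniteFlow G) (t : ℕ)
    {x : Fin m → ℝ} (hx : ∀ i, x i ∈ Set.Icc (0 : ℝ) 1) {d : ℝ} (hd : 0 < d) {p q : Fin m}
    (hpq : x p + d ≤ x q) :
    ∃ n, (d / (m + 1) / 4) * (d / (m + 1) / 2) ^ 2 ≤
      ∑ k ∈ Finset.range n, dissipation (G (t + k)) (stateTrajectory G t x k) := by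
  classical
  obtain ⟨S, a, b, hS, hS', hab, ha, hb⟩ := exists_gap hd hpq
  set δ : ℝ := d / (m + 1)
  have hδ : 0 < δ := by positivity
  have h0 : ∀ k, 0 ≤ cutFlow (G k) S := fun k => cutFlow_nonneg (hG k) S
  have hex : ∃ n, δ / 4 ≤ ∑ k ∈ Finset.range n, cutFlow (G (t + k)) S := by
    obtain ⟨n, hn⟩ := ((hflow S hS hS').eventually_ge_atTop
      (δ / 4 + ∑ k ∈ Finset.range t, cutFlow (G k) S)).exists
    refine ⟨n, ?_⟩
    have h1 : ∑ k ∈ Finset.range n, cutFlow (G k) S ≤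
        ∑ k ∈ Finset.range (t + n), cutFlow (G k) S :=
      Finset.sum_le_sum_of_subset_of_nonneg (Finset.range_mono (by omega)) fun k _ _ => h0 k
    rw [Finset.sum_range_add] at h1
    linarith
  -- Stop at the first time the flow reaches `δ / 4`. The state at each earlier step has seen less
  -- flow than that, so each cluster has moved by less than `δ / 4` and the gap is still at least `δ
  -- / 2`.
  refine ⟨Nat.find hex, ?_⟩
  calc δ / 4 * (δ / 2) ^ 2
      ≤ (∑ k ∈ Finset.range (Nat.find hex), cutFlow (G (t + k)) S) * (δ / 2) ^ 2 := by
        gcongr; exact Nat.find_spec hex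
    _ ≤ _ := by
        rw [Finset.sum_mul]
        refine Finset.sum_le_sum fun k hk => ?_
        have hlt := not_le.1 (Nat.find_min hex (Finset.mem_range.1 hk))
        have hc := stateTrajectory_cluster_bounds hG t hx ha hb k
        refine cutFlow_mul_sq_le_dissipation (hG _) (by positivity) fun i hi j hj => ?_
        linarith [hc.1 i hi, hc.2 j hj]

/-- Under infinite flow, a trajectory with finite total dissipation reaches consensus. -/
theorem exists_tendsto_of_summable_dissipation {G : ℕ → Matrix (Fin m) (Fin m) ℝ}
    (hG : ∀ k, G k ∈ Matrix.rowStochastic ℝ (Fin m)) (hflow : HasInfiniteFlow G) (t : ℕ)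
    {x : Fin m → ℝ} (hx : ∀ i, x i ∈ Set.Icc (0 : ℝ) 1)
    (hsum : Summable fun k => dissipation (G (t + k)) (stateTrajectory G t x k)) :
    ∃ g : ℝ, ∀ i, Tendsto (fun n => stateTrajectory G t x n i) atTop (𝓝 g) := by
  rcases isEmpty_or_nonempty (Fin m) with hm | hm
  · exact ⟨0, fun i => hm.elim i⟩
  set y := stateTrajectory G t x
  have hyI : ∀ n i, y n i ∈ Set.Icc (0 : ℝ) 1 := stateTrajectory_mem_Icc hG t hx
  have hstep : ∀ n, y (n + 1) = (G (t + n)).mulVec (y n) := fun n => rfl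
  have hadd : ∀ s k, y (s + k) = stateTrajectory G (t + s) (y s) k := stateTrajectory_add G t x
  clear_value y
  choose p hp using fun n => Finite.exists_min (y n)
  choose q hq using fun n => Finite.exists_max (y n)
  have hmono : Monotone fun n => y n (p n) := monotone_nat_of_le_succ fun n => by
    rw [hstep]
    exact le_mulVec_of_rowStochastic (hG _) (hp n) _
  have hanti : Antitone fun n => y n (q n) := antitone_nat_of_succ_le fun n => by
    rw [hstep]
    exact mulVec_le_of_rowStochastic (hG _) (hq n) _
  have hlo := tendsto_atTop_ciSup hmono ⟨1, by rintro _ ⟨n, rfl⟩; exact (hyI n _).2⟩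
  have hhi := tendsto_atTop_ciInf hanti ⟨0, by rintro _ ⟨n, rfl⟩; exact (hyI n _).1⟩
  set lo := ⨆ n, y n (p n)
  set hi := ⨅ n, y n (q n)
  have hle : lo ≤ hi := le_of_tendsto_of_tendsto' hlo hhi fun n => hp n _
  rcases hle.eq_or_lt with heq | hlt
  · exact ⟨lo, fun i => tendsto_of_tendsto_of_tendsto_of_le_of_le hlo (heq ▸ hhi)
      (fun n => hp n i) fun n => hq n i⟩
  exfalso
  have hd : 0 < hi - lo := sub_pos.2 hlt
  set c := ((hi - lo) / (m + 1) / 4) * ((hi - lo) / (m + 1) / 2) ^ 2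
  have hc : 0 < c := by positivity
  -- After time `s` less than `c` is left to dissipate, yet the spread at `s` is still at least `hi
  -- - lo`, which costs `c`.
  obtain ⟨s, hs⟩ := ((tendsto_sum_nat_add fun k => dissipation (G (t + k)) (y k)).eventually_lt_const
    hc).exists
  obtain ⟨n, hn⟩ := exists_le_sum_dissipation hG hflow (t + s) (hyI s) hd
    (p := p s) (q := q s) (by linarith [hmono.ge_of_tendsto hlo s, hanti.le_of_tendsto hhi s])
  have hsum' := (summable_nat_add_iff (f := fun k => dissipation (G (t + k)) (y k)) s).2 hsum
  have hfin := hsum'.sum_le_tsum (Finset.range n) fun k _ => dissipation_nonneg (hG _) _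
  have heq : ∑ k ∈ Finset.range n, dissipation (G (t + (k + s))) (y (k + s)) =
      ∑ k ∈ Finset.range n,
        dissipation (G (t + s + k)) (stateTrajectory G (t + s) (y s) k) := by
    refine Finset.sum_congr rfl fun k _ => ?_
    rw [add_comm k s, hadd, add_assoc]
  exact (hn.trans (heq ▸ hfin)).not_gt hs

end Deterministic

/-! ### Measurability and independence along random trajectories. -/

section Probability

variable {Ω : Type*} [MeasurableSpace Ω] {P : Measure Ω} {m : ℕ}

lemma measurable_matrix_entry (i j : Fin m) :
    Measurable fun A : Matrix (Fin m) (Fin m) ℝ => A i j :=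
  (continuous_id.matrix_elem i j).measurable

/-- Nonnegative random variables with bounded total expectation are almost surely summable. -/
lemma ae_summable_of_sum_integral_le {f : ℕ → Ω → ℝ} (hint : ∀ n, Integrable (f n) P)
    (h0 : ∀ n ω, 0 ≤ f n ω) {C : ℝ} (hC : ∀ n, ∑ k ∈ Finset.range n, ∫ ω, f k ω ∂P ≤ C) :
    ∀ᵐ ω ∂P, Summable fun n => f n ω := by
  have hm : ∀ n, AEMeasurable (fun ω => ENNReal.ofReal (f n ω)) P := fun n =>
    (hint n).aemeasurable.ennreal_ofReal
  have hs : Summable fun n => ∫ ω, f n ω ∂P :=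
    summable_of_sum_range_le (fun n => integral_nonneg (h0 n)) hC
  have hfin : ∫⁻ ω, ∑' n, ENNReal.ofReal (f n ω) ∂P ≠ ⊤ := by
    rw [lintegral_tsum hm]
    simp_rw [← fun n => ofReal_integral_eq_lintegral_ofReal (hint n) (ae_of_all _ (h0 n))]
    exact hs.tsum_ofReal_ne_top
  filter_upwards [ae_lt_top' (AEMeasurable.tsum hm) hfin] with ω hω
  refine (ENNReal.summable_toReal hω.ne).congr fun n => ?_
  exact ENNReal.toReal_ofReal (h0 n ω)

lemma measurable_stateTrajectory (t : ℕ) (x : Fin m → ℝ) (n : ℕ) :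
    Measurable fun G : ℕ → Matrix (Fin m) (Fin m) ℝ => stateTrajectory G t x n := by
  induction n with
  | zero => exact measurable_const
  | succ n ih =>
    refine measurable_pi_lambda _ fun i => ?_
    have h1 : ∀ j, Measurable fun G : ℕ → Matrix (Fin m) (Fin m) ℝ => G (t + n) i j := fun j =>
      (measurable_matrix_entry i j).comp (measurable_pi_apply (t + n))
    have h2 : ∀ j, Measurable fun G : ℕ → Matrix (Fin m) (Fin m) ℝ => stateTrajectory G t x n j :=
      fun j => (measurable_pi_apply j).comp ih
    simp only [stateTrajectory, Matrix.mulVec, dotProduct]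
    exact Finset.measurable_sum _ fun j _ => (h1 j).mul (h2 j)

lemma stateTrajectory_congr {G H : ℕ → Matrix (Fin m) (Fin m) ℝ} (t : ℕ) (x : Fin m → ℝ) {n : ℕ}
    (h : ∀ k < t + n, G k = H k) : stateTrajectory G t x n = stateTrajectory H t x n := by
  induction n with
  | zero => rfl
  | succ n ih =>
    rw [stateTrajectory, stateTrajectory, ih fun k hk => h k (by omega), h _ (by omega)]

/-- The state at time `t + n` is independent of the matrix applied next. -/
lemma indepFun_stateTrajectory {W : ℕ → Ω → Matrix (Fin m) (Fin m) ℝ}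
    (hmeas : ∀ k, Measurable (W k)) (hindep : iIndepFun W P) (t : ℕ) (x : Fin m → ℝ) (n : ℕ) :
    IndepFun (fun ω => stateTrajectory (fun k => W k ω) t x n) (W (t + n)) P := by
  have h := hindep.indepFun_finset (Finset.range (t + n)) {t + n} (by simp) hmeas
  -- Extending the first `t + n` matrices by zero does not affect the trajectory at step `n`, which
  -- reads only those indices.
  let ext : (Finset.range (t + n) → Matrix (Fin m) (Fin m) ℝ) → ℕ → Matrix (Fin m) (Fin m) ℝ :=
    fun f k => if hk : k ∈ Finset.range (t + n) then f ⟨k, hk⟩ else 0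
  have hext : Measurable ext := by
    refine measurable_pi_lambda _ fun k => ?_
    by_cases hk : k ∈ Finset.range (t + n)
    · simp only [ext, hk, dite_true]
      exact measurable_pi_apply _
    · simp only [ext, hk, dite_false]
      exact measurable_const
  have h' := h.comp ((measurable_stateTrajectory t x n).comp hext)
    (measurable_pi_apply (⟨t + n, Finset.mem_singleton_self _⟩ : ({t + n} : Finset ℕ)))
  refine h'.congr (ae_of_all _ fun ω => ?_) (ae_of_all _ fun ω => rfl)
  symm
  refine stateTrajectory_congr t x fun k hk => ?_
  simp [ext, hk]

/-- Factorization of expectations for a state independent of the matrix. -/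
lemma integral_matrix_mul_state {A : Ω → Matrix (Fin m) (Fin m) ℝ} {Y : Ω → Fin m → ℝ}
    (hA : Measurable A) (hY : Measurable Y) (hind : IndepFun Y A P)
    {φ : Matrix (Fin m) (Fin m) ℝ → ℝ} {ψ : (Fin m → ℝ) → ℝ} (hφ : Measurable φ)
    (hψ : Measurable ψ) :
    ∫ ω, φ (A ω) * ψ (Y ω) ∂P = (∫ ω, φ (A ω) ∂P) * ∫ ω, ψ (Y ω) ∂P :=
  (hind.symm.comp hφ hψ).integral_fun_mul_eq_mul_integral
    (hφ.comp hA).aestronglyMeasurable (hψ.comp hY).aestronglyMeasurable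

/-! ### Decay of the expected energy. -/

variable [IsProbabilityMeasure P]

lemma integrable_of_mem_Icc {f : Ω → ℝ} (hf : Measurable f) {a b : ℝ}
    (h : ∀ ω, f ω ∈ Set.Icc a b) : Integrable f P :=
  Integrable.of_mem_Icc a b hf.aemeasurable (ae_of_all _ h)

/-- Squared mean equals mean square minus variance, the variance being half the mean squared
difference of two independent copies. -/
lemma sq_sum_eq_sub_half_sum_sq_sub {w y : Fin m → ℝ} (hw : ∑ i, w i = 1) :
    (∑ i, w i * y i) ^ 2 =
      ∑ i, w i * y i ^ 2 - (∑ i, ∑ j, w i * w j * (y i - y j) ^ 2) / 2 := by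
  have h1 : ∑ i, ∑ j, w i * w j * y i ^ 2 = ∑ i, w i * y i ^ 2 := by
    refine Finset.sum_congr rfl fun i _ => ?_
    calc ∑ j, w i * w j * y i ^ 2 = ∑ j, w j * (w i * y i ^ 2) :=
          Finset.sum_congr rfl fun j _ => by ring
      _ = _ := by rw [← Finset.sum_mul, hw, one_mul]
  have h2 : ∑ i, ∑ j, w i * w j * y j ^ 2 = ∑ i, w i * y i ^ 2 := by
    rw [Finset.sum_comm, ← h1]
    exact Finset.sum_congr rfl fun i _ => Finset.sum_congr rfl fun j _ => by ring
  have h3 : (∑ i, w i * y i) ^ 2 = ∑ i, ∑ j, w i * w j * (y i * y j) := by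
    rw [sq, Finset.sum_mul_sum]
    exact Finset.sum_congr rfl fun i _ => Finset.sum_congr rfl fun j _ => by ring
  have h4 : ∑ i, ∑ j, w i * w j * (y i - y j) ^ 2 =
      ∑ i, ∑ j, w i * w j * y i ^ 2 + ∑ i, ∑ j, w i * w j * y j ^ 2
        - 2 * ∑ i, ∑ j, w i * w j * (y i * y j) := by
    simp only [Finset.mul_sum, ← Finset.sum_add_distrib, ← Finset.sum_sub_distrib]
    exact Finset.sum_congr rfl fun i _ => Finset.sum_congr rfl fun j _ => by ring
  rw [h4, h1, h2, h3]
  ring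

/-- The quadratic energy of the state in the weights `π`. -/
noncomputable def weightedEnergy (π x : Fin m → ℝ) : ℝ := ∑ l, π l * x l ^ 2

/-- The variance identity is applied to each row, and `π l` is replaced by `c` only in the
nonnegative variance term. Summing over rows produces the column inner products of the weak feedback
property. -/
lemma weightedEnergy_mulVec_le {A : Matrix (Fin m) (Fin m) ℝ}
    (hA : A ∈ Matrix.rowStochastic ℝ (Fin m)) {π : Fin m → ℝ} {c : ℝ} (hc : ∀ l, c ≤ π l)
    (y : Fin m → ℝ) :
    weightedEnergy π (A.mulVec y) ≤ (∑ i, ∑ l, π l * (A l i * y i ^ 2)) -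
      c / 2 * ∑ i, ∑ j, (∑ l, A l i * A l j) * (y i - y j) ^ 2 := by
  have hrow : ∀ l, π l * (A.mulVec y l) ^ 2 ≤ (∑ i, π l * (A l i * y i ^ 2)) -
      c / 2 * ∑ i, ∑ j, A l i * A l j * (y i - y j) ^ 2 := fun l => by
    have h := sq_sum_eq_sub_half_sum_sq_sub (y := y) (rowStochastic_row_sum hA l)
    have h0 : 0 ≤ ∑ i, ∑ j, A l i * A l j * (y i - y j) ^ 2 :=
      Finset.sum_nonneg fun i _ => Finset.sum_nonneg fun j _ => mul_nonneg
        (mul_nonneg (rowStochastic_entry_nonneg hA l i) (rowStochastic_entry_nonneg hA l j))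
        (sq_nonneg _)
    rw [← Finset.mul_sum, Matrix.mulVec, dotProduct, h]
    nlinarith [mul_le_mul_of_nonneg_right (hc l) h0]
  refine (Finset.sum_le_sum fun l _ => hrow l).trans_eq ?_
  rw [Finset.sum_sub_distrib, Finset.sum_comm, ← Finset.mul_sum]
  congr 2
  rw [Finset.sum_comm]
  refine Finset.sum_congr rfl fun i _ => ?_
  rw [Finset.sum_comm]
  exact Finset.sum_congr rfl fun j _ => (Finset.sum_mul _ _ _).symm

lemma measurable_dissipation {A : Ω → Matrix (Fin m) (Fin m) ℝ} {Y : Ω → Fin m → ℝ}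
    (hA : Measurable A) (hY : Measurable Y) : Measurable fun ω => dissipation (A ω) (Y ω) := by
  have hAm : ∀ i j, Measurable fun ω => A ω i j := fun i j => (measurable_matrix_entry i j).comp hA
  have hYm : ∀ i, Measurable fun ω => Y ω i := fun i => (measurable_pi_apply i).comp hY
  unfold dissipation
  fun_prop

lemma sq_sub_mem_Icc {a b : ℝ} (ha : a ∈ Set.Icc (0 : ℝ) 1) (hb : b ∈ Set.Icc (0 : ℝ) 1) :
    (a - b) ^ 2 ∈ Set.Icc (0 : ℝ) 1 :=
  ⟨sq_nonneg _, by nlinarith [ha.1, ha.2, hb.1, hb.2]⟩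

/-- Under weak feedback and a common steady state, the expected energy decreases at least by a
multiple of the expected dissipation. -/
lemma integral_weightedEnergy_add_dissipation_le {A : Ω → Matrix (Fin m) (Fin m) ℝ}
    {Y : Ω → Fin m → ℝ} (hA : Measurable A) (hY : Measurable Y) (hind : IndepFun Y A P)
    (hstoch : ∀ ω, A ω ∈ Matrix.rowStochastic ℝ (Fin m))
    (hYI : ∀ ω i, Y ω i ∈ Set.Icc (0 : ℝ) 1) {π : Fin m → ℝ} {c γ : ℝ} (hc0 : 0 ≤ c)
    (hc : ∀ l, c ≤ π l) (hπ : ∀ i, ∑ l, π l * ∫ ω, A ω l i ∂P = π i)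
    (hfb : ∀ i j, i ≠ j → γ * ((∫ ω, A ω i j ∂P) + ∫ ω, A ω j i ∂P) ≤
      ∫ ω, (∑ l, A ω l i * A ω l j) ∂P) :
    (∫ ω, weightedEnergy π ((A ω).mulVec (Y ω)) ∂P) +
        c * γ / 2 * ∫ ω, dissipation (A ω) (Y ω) ∂P ≤
      ∫ ω, weightedEnergy π (Y ω) ∂P := by
  have hAe := fun i j => measurable_matrix_entry (m := m) i j
  have hAm : ∀ i j, Measurable fun ω => A ω i j := fun i j => (hAe i j).comp hA
  have hYm : ∀ i, Measurable fun ω => Y ω i := fun i => (measurable_pi_apply i).comp hY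
  have hA0 : ∀ ω i j, 0 ≤ A ω i j := fun ω => rowStochastic_entry_nonneg (hstoch ω)
  have hA1 : ∀ ω i j, A ω i j ≤ 1 := fun ω => rowStochastic_entry_le_one (hstoch ω)
  have hsq : ∀ ω i j, (Y ω i - Y ω j) ^ 2 ∈ Set.Icc (0 : ℝ) 1 := fun ω i j =>
    sq_sub_mem_Icc (hYI ω i) (hYI ω j)
  have hmulI : ∀ {a b : ℝ}, a ∈ Set.Icc (0 : ℝ) 1 → b ∈ Set.Icc (0 : ℝ) 1 →
      a * b ∈ Set.Icc (0 : ℝ) 1 := fun ha hb => unitInterval.mul_mem ha hb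
  have hY2 : ∀ ω i, Y ω i ^ 2 ∈ Set.Icc (0 : ℝ) 1 := fun ω i => by
    rw [sq]; exact hmulI (hYI ω i) (hYI ω i)
  have hZI : ∀ ω l, ((A ω).mulVec (Y ω)) l ∈ Set.Icc (0 : ℝ) 1 := fun ω l =>
    ⟨le_mulVec_of_rowStochastic (hstoch ω) (fun i => (hYI ω i).1) l,
      mulVec_le_of_rowStochastic (hstoch ω) (fun i => (hYI ω i).2) l⟩
  have hZm : ∀ l, Measurable fun ω => ((A ω).mulVec (Y ω)) l := fun l => by
    simp only [Matrix.mulVec, dotProduct]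
    fun_prop
  have hint0 : Integrable (fun ω => weightedEnergy π ((A ω).mulVec (Y ω))) P := by
    refine integrable_finsetSum _ fun l _ => Integrable.const_mul ?_ _
    refine integrable_of_mem_Icc ((hZm l).pow_const 2) (a := 0) (b := 1) fun ω => ?_
    rw [sq]; exact hmulI (hZI ω l) (hZI ω l)
  have hint1 : ∀ i l, Integrable (fun ω => π l * (A ω l i * Y ω i ^ 2)) P := fun i l =>
    (integrable_of_mem_Icc ((hAm l i).mul ((hYm i).pow_const 2)) (a := 0) (b := 1) fun ω =>
      hmulI ⟨hA0 ω l i, hA1 ω l i⟩ (hY2 ω i)).const_mul _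
  have hint2 : ∀ i j, Integrable
      (fun ω => (∑ l, A ω l i * A ω l j) * (Y ω i - Y ω j) ^ 2) P := fun i j => by
    simp only [Finset.sum_mul]
    refine integrable_finsetSum _ fun l _ => ?_
    exact integrable_of_mem_Icc (by fun_prop) (a := 0) (b := 1) fun ω =>
      hmulI (hmulI ⟨hA0 ω l i, hA1 ω l i⟩ ⟨hA0 ω l j, hA1 ω l j⟩) (hsq ω i j)
  have hintA : ∀ i j, Integrable (fun ω => A ω i j) P := fun i j =>
    integrable_of_mem_Icc (hAm i j) (a := 0) (b := 1) fun ω => ⟨hA0 ω i j, hA1 ω i j⟩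
  have hint3 : ∀ i j, Integrable
      (fun ω => (A ω i j + A ω j i) * (Y ω i - Y ω j) ^ 2) P := fun i j => by
    simp only [add_mul]
    refine Integrable.add ?_ ?_ <;>
    exact integrable_of_mem_Icc (by fun_prop) (a := 0) (b := 1) fun ω =>
      hmulI ⟨hA0 ω _ _, hA1 ω _ _⟩ (hsq ω i j)
  have hmono : ∫ ω, weightedEnergy π ((A ω).mulVec (Y ω)) ∂P ≤
      ∫ ω, ((∑ i, ∑ l, π l * (A ω l i * Y ω i ^ 2)) -
        c / 2 * ∑ i, ∑ j, (∑ l, A ω l i * A ω l j) * (Y ω i - Y ω j) ^ 2) ∂P := by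
    refine integral_mono hint0 (Integrable.sub ?_ (Integrable.const_mul ?_ _)) fun ω =>
      weightedEnergy_mulVec_le (hstoch ω) hc (Y ω)
    · exact integrable_finsetSum _ fun i _ => integrable_finsetSum _ fun l _ => hint1 i l
    · exact integrable_finsetSum _ fun i _ => integrable_finsetSum _ fun j _ => hint2 i j
  rw [integral_sub (integrable_finsetSum _ fun i _ => integrable_finsetSum _ fun l _ => hint1 i l)
    ((integrable_finsetSum _ fun i _ => integrable_finsetSum _ fun j _ => hint2 i j).const_mul _),
    integral_const_mul] at hmono
  -- Independence splits off the mean of `A l i`, and the steady state equation sums these means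
  -- back to `π i`.
  have heq1 : ∫ ω, (∑ i, ∑ l, π l * (A ω l i * Y ω i ^ 2)) ∂P =
      ∫ ω, weightedEnergy π (Y ω) ∂P := by
    unfold weightedEnergy
    rw [integral_finsetSum _ fun i _ => integrable_finsetSum _ fun l _ => hint1 i l,
      integral_finsetSum _ fun i _ => (integrable_of_mem_Icc ((hYm i).pow_const 2)
        fun ω => hY2 ω i).const_mul _]
    refine Finset.sum_congr rfl fun i _ => ?_
    rw [integral_finsetSum _ fun l _ => hint1 i l, integral_const_mul, ← hπ i, Finset.sum_mul]
    refine Finset.sum_congr rfl fun l _ => ?_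
    rw [integral_const_mul, integral_matrix_mul_state hA hY hind (φ := fun M => M l i)
      (ψ := fun y => y i ^ 2) (hAe l i) (by fun_prop), mul_assoc]
  have hle2 : γ * ∫ ω, dissipation (A ω) (Y ω) ∂P ≤
      ∫ ω, (∑ i, ∑ j, (∑ l, A ω l i * A ω l j) * (Y ω i - Y ω j) ^ 2) ∂P := by
    unfold dissipation
    rw [integral_finsetSum _ fun i _ => integrable_finsetSum _ fun j _ => hint2 i j,
      integral_finsetSum _ fun i _ => integrable_finsetSum _ fun j _ => hint3 i j, Finset.mul_sum]
    refine Finset.sum_le_sum fun i _ => ?_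
    rw [integral_finsetSum _ fun j _ => hint2 i j, integral_finsetSum _ fun j _ => hint3 i j,
      Finset.mul_sum]
    refine Finset.sum_le_sum fun j _ => ?_
    -- Diagonal terms vanish, so feedback is needed only for `i ≠ j`.
    rcases eq_or_ne i j with rfl | hij
    · simp
    rw [integral_matrix_mul_state hA hY hind (φ := fun M => M i j + M j i)
        (ψ := fun y => (y i - y j) ^ 2) ((hAe i j).add (hAe j i)) (by fun_prop),
      integral_matrix_mul_state hA hY hind (φ := fun M => ∑ l, M l i * M l j)
        (ψ := fun y => (y i - y j) ^ 2)
        (Finset.measurable_sum _ fun l _ => (hAe l i).mul (hAe l j)) (by fun_prop),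
      integral_add (hintA i j) (hintA j i), ← mul_assoc]
    exact mul_le_mul_of_nonneg_right (hfb i j hij) (integral_nonneg fun ω => sq_nonneg _)
  have := mul_le_mul_of_nonneg_left hle2 (by positivity : 0 ≤ c / 2)
  linarith

/-- Almost surely, the total dissipation along a trajectory is finite. -/
theorem ae_summable_dissipation {W : ℕ → Ω → Matrix (Fin m) (Fin m) ℝ}
    (hmeas : ∀ k, Measurable (W k))
    (hstoch : ∀ k ω, W k ω ∈ Matrix.rowStochastic ℝ (Fin m)) (hindep : iIndepFun W P)
    {π : Fin m → ℝ} (hpos : ∀ i, 0 < π i) (hsteady : IsCommonSteadyState P W π)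
    (hfeedback : HasWeakFeedback P W) (t : ℕ) {x : Fin m → ℝ}
    (hx : ∀ i, x i ∈ Set.Icc (0 : ℝ) 1) :
    ∀ᵐ ω ∂P, Summable fun k =>
      dissipation (W (t + k) ω) (stateTrajectory (fun k => W k ω) t x k) := by
  obtain ⟨γ, hγ, hfb⟩ := hfeedback
  have hm : Nonempty (Fin m) := by
    by_contra h
    rw [not_nonempty_iff] at h
    simpa using hsteady.2.1
  obtain ⟨i₀, hi₀⟩ := Finite.exists_min π
  set Y : ℕ → Ω → Fin m → ℝ := fun n ω => stateTrajectory (fun k => W k ω) t x n with hYdef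
  have hYm : ∀ n, Measurable (Y n) := fun n =>
    (measurable_stateTrajectory t x n).comp (measurable_pi_lambda _ hmeas)
  have hYI : ∀ n ω i, Y n ω i ∈ Set.Icc (0 : ℝ) 1 := fun n ω =>
    stateTrajectory_mem_Icc (fun k => hstoch k ω) t hx n
  have hstep : ∀ n, (∫ ω, weightedEnergy π (Y (n + 1) ω) ∂P) +
      π i₀ * γ / 2 * ∫ ω, dissipation (W (t + n) ω) (Y n ω) ∂P ≤
      ∫ ω, weightedEnergy π (Y n ω) ∂P := fun n =>
    integral_weightedEnergy_add_dissipation_le (hmeas _) (hYm n)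
      (indepFun_stateTrajectory hmeas hindep t x n) (hstoch _) (hYI n) (hpos i₀).le hi₀
      (fun i => congrFun (hsteady.2.2 (t + n)) i) (hfb (t + n))
  have hE0 : ∀ n, 0 ≤ ∫ ω, weightedEnergy π (Y n ω) ∂P := fun n => integral_nonneg fun ω =>
    Finset.sum_nonneg fun l _ => mul_nonneg (hpos l).le (sq_nonneg _)
  have hκ : 0 < π i₀ * γ / 2 := by have := hpos i₀; positivity
  -- The energy drops telescope, and the energy stays nonnegative, which bounds the total expected
  -- dissipation.
  have htel : ∀ n, π i₀ * γ / 2 * ∑ k ∈ Finset.range n,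
      ∫ ω, dissipation (W (t + k) ω) (Y k ω) ∂P ≤
      (∫ ω, weightedEnergy π (Y 0 ω) ∂P) - ∫ ω, weightedEnergy π (Y n ω) ∂P := fun n => by
    induction n with
    | zero => simp
    | succ n ih =>
      rw [Finset.sum_range_succ, mul_add]
      linarith [hstep n]
  refine ae_summable_of_sum_integral_le (C := (∫ ω, weightedEnergy π (Y 0 ω) ∂P) /
    (π i₀ * γ / 2)) (fun n => ?_) (fun n ω => dissipation_nonneg (hstoch _ ω) _) fun n => ?_
  · refine integrable_of_mem_Icc (measurable_dissipation (hmeas _) (hYm n)) (a := 0)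
      (b := ∑ _i : Fin m, ∑ _j : Fin m, 2) fun ω => ⟨dissipation_nonneg (hstoch _ ω) _, ?_⟩
    refine Finset.sum_le_sum fun i _ => Finset.sum_le_sum fun j _ => ?_
    have h1 := rowStochastic_entry_le_one (hstoch (t + n) ω) i j
    have h2 := rowStochastic_entry_le_one (hstoch (t + n) ω) j i
    have h3 := sq_sub_mem_Icc (hYI n ω i) (hYI n ω j)
    have h4 := rowStochastic_entry_nonneg (hstoch (t + n) ω) i j
    have h5 := rowStochastic_entry_nonneg (hstoch (t + n) ω) j i
    calc _ ≤ (2 : ℝ) * 1 := mul_le_mul (by linarith) h3.2 h3.1 (by norm_num)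
      _ = 2 := by norm_num
  · rw [le_div_iff₀ hκ]
    linarith [htel n, hE0 n]

/-- Almost sure infinite flow implies almost sure ergodicity. -/
theorem ae_isErgodicChain_of_ae_hasInfiniteFlow {W : ℕ → Ω → Matrix (Fin m) (Fin m) ℝ}
    (hmeas : ∀ k, Measurable (W k))
    (hstoch : ∀ k ω, W k ω ∈ Matrix.rowStochastic ℝ (Fin m)) (hindep : iIndepFun W P)
    {π : Fin m → ℝ} (hpos : ∀ i, 0 < π i) (hsteady : IsCommonSteadyState P W π)
    (hfeedback : HasWeakFeedback P W) (hflow : ∀ᵐ ω ∂P, HasInfiniteFlow fun k => W k ω) :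
    ∀ᵐ ω ∂P, IsErgodicChain fun k => W k ω := by
  have hI : ∀ j i : Fin m, (Pi.single j 1 : Fin m → ℝ) i ∈ Set.Icc (0 : ℝ) 1 := fun j i => by
    by_cases h : i = j <;> simp [h]
  have hall : ∀ᵐ ω ∂P, ∀ (t : ℕ) (j : Fin m), Summable fun k =>
      dissipation (W (t + k) ω) (stateTrajectory (fun k => W k ω) t (Pi.single j 1) k) := by
    rw [ae_all_iff]; intro t
    rw [ae_all_iff]; intro j
    exact ae_summable_dissipation hmeas hstoch hindep hpos hsteady hfeedback t (hI j)
  filter_upwards [hflow, hall] with ω hω hs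
  rw [isErgodicChain_iff_stateTrajectory]
  exact fun t j => exists_tendsto_of_summable_dissipation (fun k => hstoch k ω) hω t (hI j) (hs t j)

/-! ### The expected chain. -/

lemma integrable_entry {A : Ω → Matrix (Fin m) (Fin m) ℝ} (hA : Measurable A)
    (hstoch : ∀ ω, A ω ∈ Matrix.rowStochastic ℝ (Fin m)) (i j : Fin m) :
    Integrable (fun ω => A ω i j) P :=
  integrable_of_mem_Icc ((measurable_matrix_entry i j).comp hA) (a := 0) (b := 1) fun ω =>
    ⟨rowStochastic_entry_nonneg (hstoch ω) i j, rowStochastic_entry_le_one (hstoch ω) i j⟩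

lemma expectedChain_mem_rowStochastic {W : ℕ → Ω → Matrix (Fin m) (Fin m) ℝ}
    (hmeas : ∀ k, Measurable (W k))
    (hstoch : ∀ k ω, W k ω ∈ Matrix.rowStochastic ℝ (Fin m)) (k : ℕ) :
    expectedChain P W k ∈ Matrix.rowStochastic ℝ (Fin m) := by
  rw [Matrix.mem_rowStochastic_iff_sum]
  refine ⟨fun i j => integral_nonneg fun ω => rowStochastic_entry_nonneg (hstoch k ω) i j,
    fun i => ?_⟩
  simp only [expectedChain, Matrix.of_apply]
  rw [← integral_finsetSum _ fun j _ => integrable_entry (hmeas k) (hstoch k) i j]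
  simp [fun ω => rowStochastic_row_sum (hstoch k ω) i]

/-- The expected trajectory is the trajectory of the expected chain. -/
lemma integral_stateTrajectory {W : ℕ → Ω → Matrix (Fin m) (Fin m) ℝ}
    (hmeas : ∀ k, Measurable (W k))
    (hstoch : ∀ k ω, W k ω ∈ Matrix.rowStochastic ℝ (Fin m)) (hindep : iIndepFun W P)
    (t : ℕ) {x : Fin m → ℝ} (hx : ∀ i, x i ∈ Set.Icc (0 : ℝ) 1) (n : ℕ) (i : Fin m) :
    ∫ ω, stateTrajectory (fun k => W k ω) t x n i ∂P =
      stateTrajectory (expectedChain P W) t x n i := by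
  induction n generalizing i with
  | zero => simp [stateTrajectory]
  | succ n ih =>
    have hYm : Measurable fun ω => stateTrajectory (fun k => W k ω) t x n :=
      (measurable_stateTrajectory t x n).comp (measurable_pi_lambda _ hmeas)
    simp only [stateTrajectory, Matrix.mulVec, dotProduct]
    rw [integral_finsetSum]
    · refine Finset.sum_congr rfl fun j _ => ?_
      rw [integral_matrix_mul_state (hmeas (t + n)) hYm
        (indepFun_stateTrajectory hmeas hindep t x n) (φ := fun M => M i j) (ψ := fun y => y j)
        (measurable_matrix_entry i j) (measurable_pi_apply j), ih j]
      rfl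
    · intro j _
      refine integrable_of_mem_Icc (((measurable_matrix_entry i j).comp (hmeas _)).mul
        ((measurable_pi_apply j).comp hYm)) (a := 0) (b := 1) fun ω => ?_
      exact unitInterval.mul_mem ⟨rowStochastic_entry_nonneg (hstoch _ ω) i j,
        rowStochastic_entry_le_one (hstoch _ ω) i j⟩
        (stateTrajectory_mem_Icc (fun k => hstoch k ω) t hx n j)

/-- Almost sure ergodicity passes to the expected chain. -/
theorem isErgodicChain_expectedChain {W : ℕ → Ω → Matrix (Fin m) (Fin m) ℝ}
    (hmeas : ∀ k, Measurable (W k))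
    (hstoch : ∀ k ω, W k ω ∈ Matrix.rowStochastic ℝ (Fin m)) (hindep : iIndepFun W P)
    (h : ∀ᵐ ω ∂P, IsErgodicChain fun k => W k ω) : IsErgodicChain (expectedChain P W) := by
  rw [isErgodicChain_iff_stateTrajectory]
  intro t j
  have hI : ∀ i : Fin m, (Pi.single j 1 : Fin m → ℝ) i ∈ Set.Icc (0 : ℝ) 1 := fun i => by
    by_cases h : i = j <;> simp [h]
  -- The limit is chosen separately for each `ω`; dominated convergence asks measurability only of
  -- the approximating functions.
  obtain ⟨g, hg⟩ := Filter.Eventually.choice (h.mono fun ω hω =>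
    (isErgodicChain_iff_stateTrajectory _).1 hω t j)
  refine ⟨∫ ω, g ω ∂P, fun i => ?_⟩
  simp_rw [← integral_stateTrajectory hmeas hstoch hindep t hI]
  refine tendsto_integral_of_dominated_convergence (fun _ => 1) (fun n => ?_)
    (integrable_const 1) (fun n => ae_of_all _ fun ω => ?_) (hg.mono fun ω hω => hω i)
  · exact ((measurable_pi_apply i).comp ((measurable_stateTrajectory t _ n).comp
      (measurable_pi_lambda _ hmeas))).aestronglyMeasurable
  · have := stateTrajectory_mem_Icc (fun k => hstoch k ω) t hI n i
    rw [Real.norm_eq_abs, abs_of_nonneg this.1]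
    exact this.2

/-! ### Almost sure divergence of the flow. -/

lemma exp_neg_le_one_sub_half {y : ℝ} (h0 : 0 ≤ y) (h1 : y ≤ 1) :
    Real.exp (-y) ≤ 1 - y / 2 := by
  have h := Real.add_one_le_exp y
  have hm : Real.exp (-y) * Real.exp y = 1 := by rw [← Real.exp_add]; simp
  have hp := Real.exp_pos (-y)
  -- Indeed `exp (-y) ≤ 1 / (1 + y)`, and `(1 - y / 2) * (1 + y) ≥ 1` on the unit interval.
  nlinarith [mul_le_mul_of_nonneg_left h hp.le]

/-- Independent uniformly bounded nonnegative random variables with divergent total expectation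
have almost surely divergent sum. -/
theorem ae_tendsto_sum_atTop_of_iIndepFun {X : ℕ → Ω → ℝ} (hmeas : ∀ k, Measurable (X k))
    (hindep : iIndepFun X P) {C : ℝ} (hC : 0 < C) (hX : ∀ k ω, X k ω ∈ Set.Icc 0 C)
    (hdiv : Tendsto (fun n => ∑ k ∈ Finset.range n, ∫ ω, X k ω ∂P) atTop atTop) :
    ∀ᵐ ω ∂P, Tendsto (fun n => ∑ k ∈ Finset.range n, X k ω) atTop atTop := by
  have hint : ∀ k, Integrable (X k) P := fun k => integrable_of_mem_Icc (hmeas k) (hX k)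
  have hexpm : ∀ {f : Ω → ℝ}, Measurable f → (∀ ω, 0 ≤ f ω) →
      Integrable (fun ω => Real.exp (-C⁻¹ * f ω)) P := fun hf h0 => by
    refine integrable_of_mem_Icc (by fun_prop) (a := 0) (b := 1) fun ω =>
      ⟨(Real.exp_pos _).le, Real.exp_le_one_iff.2 ?_⟩
    have := mul_nonneg (inv_nonneg.2 hC.le) (h0 ω)
    linarith
  -- The exponent `-C⁻¹` rescales `X k` into the unit interval, where the exponential lies below `1
  -- - y / 2`; then `1 - u ≤ exp (-u)`.
  have hmgf1 : ∀ k, mgf (X k) P (-C⁻¹) ≤ Real.exp (-(C⁻¹ / 2 * ∫ ω, X k ω ∂P)) := fun k => by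
    have h1 : mgf (X k) P (-C⁻¹) ≤ ∫ ω, (1 - C⁻¹ / 2 * X k ω) ∂P := by
      refine integral_mono (hexpm (hmeas k) fun ω => (hX k ω).1)
        ((integrable_const 1).sub ((hint k).const_mul _)) fun ω => ?_
      have h := exp_neg_le_one_sub_half (y := C⁻¹ * X k ω)
        (mul_nonneg (inv_nonneg.2 hC.le) (hX k ω).1)
        (by rw [inv_mul_le_iff₀ hC]; simpa using (hX k ω).2)
      simp only [neg_mul]
      linarith
    rw [integral_sub (integrable_const 1) ((hint k).const_mul _), integral_const_mul] at h1
    have h2 := Real.add_one_le_exp (-(C⁻¹ / 2 * ∫ ω, X k ω ∂P))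
    simp only [integral_const, probReal_univ, smul_eq_mul, mul_one] at h1
    linarith
  have hmgf : ∀ n, mgf (∑ k ∈ Finset.range n, X k) P (-C⁻¹) ≤
      Real.exp (-(C⁻¹ / 2 * ∑ k ∈ Finset.range n, ∫ ω, X k ω ∂P)) := fun n => by
    rw [hindep.mgf_sum hmeas, Finset.mul_sum, ← Finset.sum_neg_distrib, Real.exp_sum]
    exact Finset.prod_le_prod (fun k _ => mgf_nonneg) fun k _ => hmgf1 k
  -- Chernoff bound: the event lies in `{S_n ≤ N}` for every `n`, with `S_n` the partial sum, and
  -- the Laplace transform of `S_n` tends to 0.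
  have hlim : ∀ N : ℕ, P.real {ω | ∀ n, ∑ k ∈ Finset.range n, X k ω ≤ N} = 0 := fun N => by
    have hb : ∀ n, P.real {ω | ∀ n, ∑ k ∈ Finset.range n, X k ω ≤ N} ≤
        Real.exp (C⁻¹ * N) *
          Real.exp (-(C⁻¹ / 2 * ∑ k ∈ Finset.range n, ∫ ω, X k ω ∂P)) := fun n => by
      have h1 := measure_le_le_exp_mul_mgf (μ := P) (X := ∑ k ∈ Finset.range n, X k)
        (N : ℝ) (t := -C⁻¹) (by simpa using hC.le)
        (hexpm (by fun_prop) fun ω => by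
          simpa using Finset.sum_nonneg fun k _ => (hX k ω).1)
      rw [neg_neg] at h1
      refine (measureReal_mono fun ω hω => ?_).trans (h1.trans
        (mul_le_mul_of_nonneg_left (hmgf n) (Real.exp_pos _).le))
      simpa using hω n
    have ht : Tendsto (fun n => Real.exp (C⁻¹ * N) *
        Real.exp (-(C⁻¹ / 2 * ∑ k ∈ Finset.range n, ∫ ω, X k ω ∂P))) atTop (𝓝 0) := by
      have h2 := Real.tendsto_exp_neg_atTop_nhds_zero.comp
        (hdiv.const_mul_atTop (show 0 < C⁻¹ / 2 by positivity))
      simpa using h2.const_mul (Real.exp (C⁻¹ * N))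
    exact le_antisymm (ge_of_tendsto' ht hb) measureReal_nonneg
  have hae : ∀ᵐ ω ∂P, ∀ N : ℕ, ¬ ∀ n, ∑ k ∈ Finset.range n, X k ω ≤ N := by
    rw [ae_all_iff]
    intro N
    rw [ae_iff]
    simpa only [not_not] using (measureReal_eq_zero_iff).1 (hlim N)
  filter_upwards [hae] with ω hω
  refine tendsto_atTop_atTop_of_monotone (monotone_nat_of_le_succ fun n => ?_) fun b => ?_
  · rw [Finset.sum_range_succ]
    linarith [(hX n ω).1]
  · obtain ⟨N, hN⟩ := exists_nat_ge b
    have := hω N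
    push Not at this
    obtain ⟨n, hn⟩ := this
    exact ⟨n, hN.trans hn.le⟩

lemma measurable_cutFlow (S : Finset (Fin m)) :
    Measurable fun A : Matrix (Fin m) (Fin m) ℝ => cutFlow A S :=
  Finset.measurable_sum _ fun i _ => Finset.measurable_sum _ fun j _ =>
    (measurable_matrix_entry i j).add (measurable_matrix_entry j i)

lemma cutFlow_expectedChain {W : ℕ → Ω → Matrix (Fin m) (Fin m) ℝ}
    (hmeas : ∀ k, Measurable (W k))
    (hstoch : ∀ k ω, W k ω ∈ Matrix.rowStochastic ℝ (Fin m)) (S : Finset (Fin m)) (k : ℕ) :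
    cutFlow (expectedChain P W k) S = ∫ ω, cutFlow (W k ω) S ∂P := by
  have hint := integrable_entry (P := P) (hmeas k) (hstoch k)
  have hadd : ∀ i j, Integrable (fun ω => W k ω i j + W k ω j i) P := fun i j =>
    (hint i j).add (hint j i)
  unfold cutFlow
  rw [integral_finsetSum _ fun i _ => integrable_finsetSum _ fun j _ => hadd i j]
  refine Finset.sum_congr rfl fun i _ => ?_
  rw [integral_finsetSum _ fun j _ => hadd i j]
  refine Finset.sum_congr rfl fun j _ => ?_
  rw [integral_add (hint i j) (hint j i)]
  rfl

lemma cutFlow_le {A : Matrix (Fin m) (Fin m) ℝ} (hA : A ∈ Matrix.rowStochastic ℝ (Fin m))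
    (S : Finset (Fin m)) : cutFlow A S ≤ ∑ _i ∈ S, ∑ _j ∈ Sᶜ, 2 :=
  Finset.sum_le_sum fun i _ => Finset.sum_le_sum fun j _ => by
    linarith [rowStochastic_entry_le_one hA i j, rowStochastic_entry_le_one hA j i]

/-- Infinite flow of the expected chain implies almost sure infinite flow. -/
theorem ae_hasInfiniteFlow_of_expectedChain {W : ℕ → Ω → Matrix (Fin m) (Fin m) ℝ}
    (hmeas : ∀ k, Measurable (W k))
    (hstoch : ∀ k ω, W k ω ∈ Matrix.rowStochastic ℝ (Fin m)) (hindep : iIndepFun W P)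
    (h : HasInfiniteFlow (expectedChain P W)) : ∀ᵐ ω ∂P, HasInfiniteFlow fun k => W k ω := by
  unfold HasInfiniteFlow
  rw [ae_all_iff]
  intro S
  by_cases hS : S.Nonempty ∧ S ≠ Finset.univ
  · have hdiv := h S hS.1 hS.2
    simp_rw [cutFlow_expectedChain hmeas hstoch] at hdiv
    -- The added 1 only makes the uniform bound visibly positive.
    have hlt : (0 : ℝ) < (∑ _i ∈ S, ∑ _j ∈ Sᶜ, 2) + 1 := by positivity
    filter_upwards [ae_tendsto_sum_atTop_of_iIndepFun
      (fun k => (measurable_cutFlow S).comp (hmeas k))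
      (hindep.comp (fun _ A => cutFlow A S) fun _ => measurable_cutFlow S) hlt
      (fun k ω => ⟨cutFlow_nonneg (hstoch k ω) S, (cutFlow_le (hstoch k ω) S).trans (le_add_of_nonneg_right zero_le_one)⟩)
      hdiv] with ω hω _ _
    exact hω
  · exact ae_of_all _ fun ω h1 h2 => absurd ⟨h1, h2⟩ hS

end Probability

theorem theorem5 {Ω : Type*} [MeasurableSpace Ω] (P : Measure Ω) [IsProbabilityMeasure P]
    {m : ℕ} (W : ℕ → Ω → Matrix (Fin m) (Fin m) ℝ)
    (hmeas : ∀ k, Measurable (W k))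
    (hstoch : ∀ k ω, W k ω ∈ Matrix.rowStochastic ℝ (Fin m))
    (hindep : iIndepFun W P)
    (π : Fin m → ℝ) (hpos : ∀ i, 0 < π i) (hsteady : IsCommonSteadyState P W π)
    (hfeedback : HasWeakFeedback P W) :
    List.TFAE
      [∀ᵐ ω ∂P, IsErgodicChain (fun k => W k ω),
       ∀ᵐ ω ∂P, HasInfiniteFlow (fun k => W k ω),
       HasInfiniteFlow (expectedChain P W),
       IsErgodicChain (expectedChain P W)] := by
  tfae_have 1 → 4 := isErgodicChain_expectedChain hmeas hstoch hindep
  tfae_have 4 → 3 := fun h =>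
    h.hasInfiniteFlow (expectedChain_mem_rowStochastic hmeas hstoch)
  tfae_have 3 → 2 := ae_hasInfiniteFlow_of_expectedChain hmeas hstoch hindep
  tfae_have 2 → 1 :=
    ae_isErgodicChain_of_ae_hasInfiniteFlow hmeas hstoch hindep hpos hsteady hfeedback
  tfae_finish
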